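/- **Setting.** For a commutative ring $R$ let $\mathbb H(R)=R+R\mathbf i+R\mathbf j+R\mathbf k$ be the Hamilton quaternions over $R$, and let $z\mapsto z^*$ be the anti-involution that switches the sign of the coefficient of $\mathbf k$. Put $$\mathrm{SV}_2(R)=\Big\{M=\begin{pmatrix}a&b\\c&d\end{pmatrix}\in M_2(\mathbb H(R)) : M\begin{pmatrix}0&1\\-1&0\end{pmatrix}\begin{pmatrix}a^*&c^*\\b^*&d^*\end{pmatrix}=\begin{pmatrix}0&1\\-1&0\end{pmatrix}\Big\},$$ $$\mathrm{GSV}_2(R)=\Big\{\begin{pmatrix}a&b\\c&d\end{pmatrix}\in M_2(\mathbb H(R)) : ad^*-bc^*\in R^\times,\ ab^*,cd^*\in R+R\mathbf i+R\mathbf j\Big\},$$ and let $\mathbf G(R)=\mathrm{PGSV}_2(R)$ be the quotient of $\mathrm{GSV}_2(R)$ by its centre. Let $\mathbf H\subset\mathbf G$ be the subgroup obtained by requiring that the coefficients of $\mathbf j$ and $\mathbf k$ in each matrix entry vanish. For a prime $p$ let $K_p$ be the image of $\mathbf G(\mathbb Z_p)$ in $\mathbf G(\mathbb Q_p)$. Let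 $g\in\mathrm{SV}_2(\overline{\mathbb Q}\cap\mathbb R)$ and let $F\subset\mathbb R$ be the smallest number field with $g\in\mathrm{SV}_2(F)$, that is, the field generated over $\mathbb Q$ by the coefficients of the entries of $g$. A prime $p$ is called good for $g$ if $p\equiv 3\pmod 4$ and there is an embedding $\varphi:F\to\mathbb Q_p$ with $\varphi(g)\in\mathrm{SV}_2(\mathbb Z_p)$. Given such an embedding $\varphi$, the group $(g\mathbf Hg^{-1})(\mathbb Q_p)$ is formed by viewing $\mathbb Q_p$ as an extension of $F$ by means of $\varphi$, so that it is the subgroup $\varphi(g)\,\mathbf H(\mathbb Q_p)\,\varphi(g)^{-1}$ of $\mathbf G(\mathbb Q_p)$. For an integer $l\ge 0$ put $$\mathcal L_{0,l}(p,g\mathbf Hg^{-1})=\Big|\Big((g\mathbf Hg^{-1})(\mathbb Q_p)\,K_p\ \cap\ K_p\begin{pmatrix}1&0\\0&p^l\end{pmatrix}K_p\Big)\Big/K_p\Big| .$$ **Proposition.** There is an absolute constant $C$ such that for every $g\in\mathrm{SV}_2(\overline{\mathbb Q}\cap\mathbb R)$, every prime $p$ that is good for $g$, every embedding $\varphi:F\to\mathbb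 Q_p$ with $\varphi(g)\in\mathrm{SV}_2(\mathbb Z_p)$ and every integer $l\ge 0$, the number $\mathcal L_{0,l}(p,g\mathbf Hg^{-1})$ is finite and $$\mathcal L_{0,l}(p,g\mathbf Hg^{-1})\le C\,p^{2l}.$$ -/

import Mathlib

open Quaternion Pointwise

namespace Quat

/-- The anti-involution `z ↦ z*` of the Hamilton quaternions over `R` which switches the sign
of the coefficient of `k` (it is not the usual conjugation). -/
def rev {R : Type*} [CommRing R] (z : ℍ[R]) : ℍ[R] := ⟨z.re, z.imI, z.imJ, -z.imK⟩

section rev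
variable {R : Type*} [CommRing R]

@[simp] theorem re_rev (z : ℍ[R]) : (rev z).re = z.re := rfl
@[simp] theorem imI_rev (z : ℍ[R]) : (rev z).imI = z.imI := rfl
@[simp] theorem imJ_rev (z : ℍ[R]) : (rev z).imJ = z.imJ := rfl
@[simp] theorem imK_rev (z : ℍ[R]) : (rev z).imK = -z.imK := rfl

theorem rev_add (x y : ℍ[R]) : rev (x + y) = rev x + rev y := by
  ext <;> simp [add_comm]

theorem rev_neg (x : ℍ[R]) : rev (-x) = -rev x := by
  ext <;> simp

theorem rev_sub (x y : ℍ[R]) : rev (x - y) = rev x - rev y := by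
  rw [sub_eq_add_neg, rev_add, rev_neg, sub_eq_add_neg]

theorem rev_mul (x y : ℍ[R]) : rev (x * y) = rev y * rev x := by
  ext <;> simp <;> ring

theorem rev_rev (x : ℍ[R]) : rev (rev x) = x := by
  ext <;> simp

theorem rev_zero : rev (0 : ℍ[R]) = 0 := by
  ext <;> simp

theorem rev_one : rev (1 : ℍ[R]) = 1 := by
  ext <;> simp

theorem rev_coe (r : R) : rev (r : ℍ[R]) = r := by
  ext <;> simp

theorem rev_eq_of_imK {x : ℍ[R]} (h : x.imK = 0) : rev x = x := by
  ext <;> simp [h]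

theorem imK_conj {v : ℍ[R]} (h : v.imK = 0) (x : ℍ[R]) : (x * v * rev x).imK = 0 := by
  simp [h]; ring

theorem imK_conj' {v : ℍ[R]} (h : v.imK = 0) (x : ℍ[R]) : (rev x * v * x).imK = 0 := by
  simp [h]; ring

theorem imK_add_rev (x : ℍ[R]) : (x + rev x).imK = 0 := by
  simp

theorem imK_coe_mul (r : R) (x : ℍ[R]) : ((r : ℍ[R]) * x).imK = r * x.imK := by
  simp

end rev

/-- The coefficientwise map of quaternions induced by a map of coefficient rings. -/
def mapFun {R S : Type*} [CommRing R] [CommRing S] (f : R →+* S) (z : ℍ[R]) : ℍ[S] :=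
  ⟨f z.re, f z.imI, f z.imJ, f z.imK⟩

section mapFun
variable {R S : Type*} [CommRing R] [CommRing S] (f : R →+* S)

@[simp] theorem re_mapFun (z : ℍ[R]) : (mapFun f z).re = f z.re := rfl
@[simp] theorem imI_mapFun (z : ℍ[R]) : (mapFun f z).imI = f z.imI := rfl
@[simp] theorem imJ_mapFun (z : ℍ[R]) : (mapFun f z).imJ = f z.imJ := rfl
@[simp] theorem imK_mapFun (z : ℍ[R]) : (mapFun f z).imK = f z.imK := rfl

end mapFun

/-- The ring homomorphism of quaternions induced, coefficientwise, by a homomorphism of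
coefficient rings. -/
def map {R S : Type*} [CommRing R] [CommRing S] (f : R →+* S) : ℍ[R] →+* ℍ[S] where
  toFun := mapFun f
  map_one' := by ext <;> simp
  map_mul' x y := by ext <;> simp
  map_zero' := by ext <;> simp
  map_add' x y := by ext <;> simp

section map
variable {R S : Type*} [CommRing R] [CommRing S] (f : R →+* S)

@[simp] theorem re_map (z : ℍ[R]) : (map f z).re = f z.re := rfl
@[simp] theorem imI_map (z : ℍ[R]) : (map f z).imI = f z.imI := rfl
@[simp] theorem imJ_map (z : ℍ[R]) : (map f z).imJ = f z.imJ := rfl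
@[simp] theorem imK_map (z : ℍ[R]) : (map f z).imK = f z.imK := rfl

theorem map_rev (z : ℍ[R]) : map f (rev z) = rev (map f z) := by
  ext <;> simp

theorem map_coe (r : R) : map f (r : ℍ[R]) = (f r : ℍ[S]) := by
  ext <;> simp

theorem map_injective {f : R →+* S} (hf : Function.Injective f) :
    Function.Injective (map f) := by
  intro x y h
  ext
  · exact hf (congrArg QuaternionAlgebra.re h)
  · exact hf (congrArg QuaternionAlgebra.imI h)
  · exact hf (congrArg QuaternionAlgebra.imJ h)
  · exact hf (congrArg QuaternionAlgebra.imK h)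

end map

end Quat

/-- `M₂(ℍ(R))`. -/
abbrev QMat (R : Type*) [CommRing R] := Matrix (Fin 2) (Fin 2) ℍ[R]

namespace QMat

/-- The matrix with rows `(a*, c*)`, `(b*, d*)` attached to the matrix with rows
`(a, b)`, `(c, d)`. -/
def dag {R : Type*} [CommRing R] (M : QMat R) : QMat R := (Matrix.map M Quat.rev).transpose

/-- The matrix with rows `(0, 1)`, `(-1, 0)`. -/
def J (R : Type*) [CommRing R] : QMat R := !![0, 1; -1, 0]

theorem dag_mul {R : Type*} [CommRing R] (M N : QMat R) : dag (M * N) = dag N * dag M := by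
  ext1 i j
  simp [dag, Matrix.mul_apply, Fin.sum_univ_two, Quat.rev_add, Quat.rev_mul]

theorem dag_one {R : Type*} [CommRing R] : dag (1 : QMat R) = 1 := by
  ext1 i j
  fin_cases i <;> fin_cases j <;> simp [dag, Quat.rev_zero, Quat.rev_one]

/-- The homomorphism of matrix rings induced by a homomorphism of coefficient rings. -/
def map {R S : Type*} [CommRing R] [CommRing S] (f : R →+* S) : QMat R →+* QMat S :=
  (Quat.map f).mapMatrix

theorem map_apply {R S : Type*} [CommRing R] [CommRing S] (f : R →+* S) (M : QMat R)
    (i j : Fin 2) : map f M i j = Quat.map f (M i j) := rfl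

theorem map_dag {R S : Type*} [CommRing R] [CommRing S] (f : R →+* S) (M : QMat R) :
    map f (dag M) = dag (map f M) := by
  ext1 i j
  simp [map_apply, dag, Quat.map_rev]

theorem map_J {R S : Type*} [CommRing R] [CommRing S] (f : R →+* S) : map f (J R) = J S := by
  ext1 i j
  fin_cases i <;> fin_cases j <;> simp [map_apply, J]

theorem map_injective {R S : Type*} [CommRing R] [CommRing S] {f : R →+* S}
    (hf : Function.Injective f) : Function.Injective (map f) := by
  intro M N h
  ext1 i j
  exact Quat.map_injective hf (congrFun (congrFun h i) j)

end QMat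

/-- `SV₂(R)`: the matrices `M` over the quaternions with `M J M† = J`. -/
def SV2 (R : Type*) [CommRing R] : Subgroup (QMat R)ˣ where
  carrier := {M | (M : QMat R) * QMat.J R * QMat.dag (M : QMat R) = QMat.J R}
  one_mem' := by simp [QMat.dag_one]
  mul_mem' {M N} hM hN := by
    simp only [Set.mem_ofPred_eq, Units.val_mul, QMat.dag_mul] at *
    calc _ = (M : QMat R) * ((N : QMat R) * QMat.J R * QMat.dag (N : QMat R))
            * QMat.dag (M : QMat R) := by simp only [mul_assoc]
      _ = _ := by rw [hN, hM]
  inv_mem' {M} hM := by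
    simp only [Set.mem_ofPred_eq] at *
    have h1 : QMat.dag (M : QMat R) * QMat.dag ((M⁻¹ : (QMat R)ˣ) : QMat R) = 1 := by
      rw [← QMat.dag_mul, Units.inv_mul, QMat.dag_one]
    calc _ = ((M⁻¹ : (QMat R)ˣ) : QMat R) *
            ((M : QMat R) * QMat.J R * QMat.dag (M : QMat R)) *
            QMat.dag ((M⁻¹ : (QMat R)ˣ) : QMat R) := by rw [hM]
      _ = (((M⁻¹ : (QMat R)ˣ) : QMat R) * (M : QMat R)) * QMat.J R *
            (QMat.dag (M : QMat R) * QMat.dag ((M⁻¹ : (QMat R)ˣ) : QMat R)) := by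
          simp only [mul_assoc]
      _ = _ := by rw [h1, Units.inv_mul, one_mul, mul_one]

/-- The conditions defining `GSV₂(R)`, for the matrix with rows `(a, b)`, `(c, d)`: the element
`a d* - b c*` is in `Rˣ`, and `a b*`, `c d*` lie in `R + R i + R j`. -/
def IsGSV2 {R : Type*} [CommRing R] (M : QMat R) : Prop :=
  (∃ μ : Rˣ, M 0 0 * Quat.rev (M 1 1) - M 0 1 * Quat.rev (M 1 0) = ((μ : R) : ℍ[R])) ∧
    (M 0 0 * Quat.rev (M 0 1)).imK = 0 ∧ (M 1 0 * Quat.rev (M 1 1)).imK = 0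

namespace IsGSV2

open Quat

theorem imK_row_mul {R : Type*} [CommRing R] {e f g h : ℍ[R]} {μ : R}
    (h1 : e * rev h - f * rev g = (μ : ℍ[R])) (h2 : (e * rev f).imK = 0)
    (h3 : (g * rev h).imK = 0) {a b : ℍ[R]} (h4 : (a * rev b).imK = 0) :
    ((a * e + b * g) * rev (a * f + b * h)).imK = 0 := by
  have h1' : e * rev h = (μ : ℍ[R]) + f * rev g := by rw [← h1]; abel
  have hc : a * ((μ : ℍ[R]) * rev b) = (μ : ℍ[R]) * (a * rev b) := by
    rw [← mul_assoc, ← mul_assoc, Quaternion.coe_commutes μ a]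
  have key : (a * e + b * g) * rev (a * f + b * h) =
      a * (e * rev f) * rev a + b * (g * rev h) * rev b + (μ : ℍ[R]) * (a * rev b)
        + (a * f * rev g * rev b + rev (a * f * rev g * rev b)) := by
    calc _ = a * (e * rev f) * rev a + b * (g * rev h) * rev b + a * (e * rev h) * rev b
          + b * g * rev f * rev a := by simp only [rev_add, rev_mul]; noncomm_ring
      _ = _ := by
        rw [h1', ← hc]
        simp only [rev_mul, rev_rev]
        noncomm_ring
  rw [key, Quaternion.imK_add, Quaternion.imK_add, Quaternion.imK_add, imK_conj h2,
    imK_conj h3, imK_coe_mul, h4, imK_add_rev]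
  simp

theorem one {R : Type*} [CommRing R] : IsGSV2 (1 : QMat R) := by
  refine ⟨⟨1, ?_⟩, ?_, ?_⟩ <;> simp [rev_one, rev_zero]

theorem mul {R : Type*} [CommRing R] {M N : QMat R} (hM : IsGSV2 M) (hN : IsGSV2 N) :
    IsGSV2 (M * N) := by
  obtain ⟨⟨μ, hM1⟩, hM2, hM3⟩ := hM
  obtain ⟨⟨ν, hN1⟩, hN2, hN3⟩ := hN
  refine ⟨⟨μ * ν, ?_⟩, ?_, ?_⟩
  · simp only [Matrix.mul_apply, Fin.sum_univ_two]
    generalize M 0 0 = a, M 0 1 = b, M 1 0 = c, M 1 1 = d at *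
    generalize N 0 0 = e, N 0 1 = f, N 1 0 = g, N 1 1 = h at *
    have e1 : f * rev e = e * rev f := by
      rw [← rev_eq_of_imK hN2, rev_mul, rev_rev]
    have e2 : h * rev g = g * rev h := by
      rw [← rev_eq_of_imK hN3, rev_mul, rev_rev]
    have e3 : h * rev e - g * rev f = ((ν : R) : ℍ[R]) := by
      rw [← rev_coe, ← hN1, rev_sub, rev_mul, rev_mul, rev_rev, rev_rev]
    have hcomm (x y : ℍ[R]) : x * (((ν : R) : ℍ[R]) * y) = ((ν : R) : ℍ[R]) * (x * y) := by
      rw [← mul_assoc, ← mul_assoc, Quaternion.coe_commutes (ν : R) x]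
    calc _ = a * ((e * rev f - f * rev e) * rev c) + a * ((e * rev h - f * rev g) * rev d)
          - b * ((h * rev e - g * rev f) * rev c) + b * ((g * rev h - h * rev g) * rev d) := by
          simp only [rev_add, rev_mul]; noncomm_ring
      _ = ((ν : R) : ℍ[R]) * (a * rev d - b * rev c) := by
          rw [e1, e2, e3, hN1, hcomm, hcomm]; noncomm_ring
      _ = _ := by
          rw [hM1, Units.val_mul, mul_comm (μ : R), Quaternion.coe_mul]
  · simp only [Matrix.mul_apply, Fin.sum_univ_two]
    exact imK_row_mul hN1 hN2 hN3 hM2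
  · simp only [Matrix.mul_apply, Fin.sum_univ_two]
    exact imK_row_mul hN1 hN2 hN3 hM3

/-- The adjugate matrix, with rows `(d*, -b*)`, `(-c*, a*)`. -/
def adj {R : Type*} [CommRing R] (M : QMat R) : QMat R :=
  !![rev (M 1 1), -rev (M 0 1); -rev (M 1 0), rev (M 0 0)]

theorem inv_apply {R : Type*} [CommRing R] {M : (QMat R)ˣ} (hM : IsGSV2 (M : QMat R))
    {μ : Rˣ} (hM1 : (M : QMat R) 0 0 * Quat.rev ((M : QMat R) 1 1) -
      (M : QMat R) 0 1 * Quat.rev ((M : QMat R) 1 0) = ((μ : R) : ℍ[R])) :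
    adj (M : QMat R) * (M : QMat R) = (μ : R) • (1 : QMat R) ∧
    ∀ i j, ((M⁻¹ : (QMat R)ˣ) : QMat R) i j =
      (((μ⁻¹ : Rˣ) : R) : ℍ[R]) * adj (M : QMat R) i j := by
  obtain ⟨-, hM2, hM3⟩ := hM
  have e1 : (M : QMat R) 0 1 * rev ((M : QMat R) 0 0) =
      (M : QMat R) 0 0 * rev ((M : QMat R) 0 1) := by
    rw [← rev_eq_of_imK hM2, rev_mul, rev_rev]
  have e2 : (M : QMat R) 1 1 * rev ((M : QMat R) 1 0) =
      (M : QMat R) 1 0 * rev ((M : QMat R) 1 1) := by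
    rw [← rev_eq_of_imK hM3, rev_mul, rev_rev]
  have e3 : (M : QMat R) 1 1 * rev ((M : QMat R) 0 0) -
      (M : QMat R) 1 0 * rev ((M : QMat R) 0 1) = ((μ : R) : ℍ[R]) := by
    rw [← rev_coe, ← hM1, rev_sub, rev_mul, rev_mul, rev_rev, rev_rev]
  have h1 : (M : QMat R) * adj (M : QMat R) = (μ : R) • (1 : QMat R) := by
    ext1 i j
    fin_cases i <;> fin_cases j
    · simp [adj, Matrix.mul_apply, Fin.sum_univ_two]
      rw [← sub_eq_add_neg, hM1]; ext <;> simp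
    · simp [adj, Matrix.mul_apply, Fin.sum_univ_two, e1]
    · simp [adj, Matrix.mul_apply, Fin.sum_univ_two, e2]
    · simp [adj, Matrix.mul_apply, Fin.sum_univ_two]
      rw [neg_add_eq_sub, e3]; ext <;> simp
  have h2 : adj (M : QMat R) = (μ : R) • ((M⁻¹ : (QMat R)ˣ) : QMat R) := by
    calc _ = ((M⁻¹ : (QMat R)ˣ) : QMat R) * ((M : QMat R) * adj (M : QMat R)) := by
          rw [← mul_assoc, Units.inv_mul, one_mul]
      _ = _ := by rw [h1, mul_smul_comm, mul_one]
  have h3 : adj (M : QMat R) * (M : QMat R) = (μ : R) • (1 : QMat R) := by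
    rw [h2, smul_mul_assoc, Units.inv_mul]
  refine ⟨h3, fun i j => ?_⟩
  rw [h2]; simp [Quaternion.coe_mul_eq_smul, smul_smul]

theorem inv {R : Type*} [CommRing R] {M : (QMat R)ˣ} (hM : IsGSV2 (M : QMat R)) :
    IsGSV2 ((M⁻¹ : (QMat R)ˣ) : QMat R) := by
  have hM' := hM
  obtain ⟨⟨μ, hM1⟩, hM2, hM3⟩ := hM
  obtain ⟨h3, h4⟩ := inv_apply hM' hM1
  clear hM'
  have e1 : (M : QMat R) 0 1 * rev ((M : QMat R) 0 0) =
      (M : QMat R) 0 0 * rev ((M : QMat R) 0 1) := by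
    rw [← rev_eq_of_imK hM2, rev_mul, rev_rev]
  have e2 : (M : QMat R) 1 1 * rev ((M : QMat R) 1 0) =
      (M : QMat R) 1 0 * rev ((M : QMat R) 1 1) := by
    rw [← rev_eq_of_imK hM3, rev_mul, rev_rev]
  have e3 : (M : QMat R) 1 1 * rev ((M : QMat R) 0 0) -
      (M : QMat R) 1 0 * rev ((M : QMat R) 0 1) = ((μ : R) : ℍ[R]) := by
    rw [← rev_coe, ← hM1, rev_sub, rev_mul, rev_mul, rev_rev, rev_rev]
  have f1 := congrFun (congrFun h3 0) 0
  have f2 := congrFun (congrFun h3 0) 1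
  have f3 := congrFun (congrFun h3 1) 0
  have f4 := congrFun (congrFun h3 1) 1
  unfold IsGSV2
  simp only [h4]
  clear h4
  simp only [adj, Matrix.mul_apply, Fin.sum_univ_two, Matrix.of_apply, Matrix.cons_val',
    Matrix.cons_val_zero, Matrix.cons_val_one, Matrix.cons_val_fin_one, Matrix.smul_apply,
    Matrix.one_apply_eq, Fin.isValue, ne_eq, zero_ne_one, one_ne_zero, not_false_eq_true,
    Matrix.one_apply_ne, smul_zero] at *
  generalize (M : QMat R) 0 0 = a, (M : QMat R) 0 1 = b, (M : QMat R) 1 0 = c,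
    (M : QMat R) 1 1 = d at *
  have hs : (μ : R) • (1 : ℍ[R]) = ((μ : R) : ℍ[R]) := by ext <;> simp
  rw [hs] at f1 f4
  have g1 : rev d * a = ((μ : R) : ℍ[R]) + rev b * c := by rw [← f1]; noncomm_ring
  have g2 : rev b * d = rev d * b := by
    rw [← sub_eq_zero, ← neg_eq_zero, ← f2]; noncomm_ring
  have g3 : rev a * c = rev c * a := by
    rw [← sub_eq_zero, ← f3]; noncomm_ring
  have g4 : rev a * d = ((μ : R) : ℍ[R]) + rev c * b := by rw [← f4]; noncomm_ring
  have cancel {x : ℍ[R]} (h : (((μ : R) : ℍ[R]) * x).imK = 0) : x.imK = 0 := by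
    rw [imK_coe_mul] at h
    exact (Units.mul_right_eq_zero μ).mp h
  have k1 : (rev d * b).imK = 0 := by
    apply cancel
    have : ((μ : R) : ℍ[R]) * (rev d * b) =
        rev d * (a * rev b) * d - rev b * (c * rev d) * b := by
      calc _ = (((μ : R) : ℍ[R]) + rev b * c) * (rev d * b) - rev b * (c * rev d) * b := by
            noncomm_ring
        _ = _ := by rw [← g1, ← g2]; noncomm_ring
    rw [this, Quaternion.imK_sub, imK_conj' hM2, imK_conj' hM3, sub_zero]
  have k2 : (rev c * a).imK = 0 := by
    apply cancel
    have : ((μ : R) : ℍ[R]) * (rev c * a) =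
        rev a * (c * rev d) * a - rev c * (a * rev b) * c := by
      calc _ = (((μ : R) : ℍ[R]) + rev c * b) * (rev c * a) - rev c * b * (rev c * a) := by
            noncomm_ring
        _ = rev a * (d * rev c) * a - rev c * (b * rev a) * c := by
            rw [← g4]
            simp only [mul_assoc, g3]
        _ = _ := by rw [e1, e2]
    rw [this, Quaternion.imK_sub, imK_conj' hM2, imK_conj' hM3, sub_zero]
  have pull (x y : ℍ[R]) (r : R) : ((r : ℍ[R]) * x) * rev ((r : ℍ[R]) * y) =
      ((r * r : R) : ℍ[R]) * (x * rev y) := by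
    rw [rev_mul, rev_coe, ← Quaternion.coe_commutes r (rev y), Quaternion.coe_mul,
      mul_assoc, mul_assoc, ← mul_assoc x, ← Quaternion.coe_commutes r x, mul_assoc]
  refine ⟨⟨μ⁻¹, ?_⟩, ?_, ?_⟩
  · rw [pull, pull, ← mul_sub, rev_rev, rev_neg, rev_rev, neg_mul_neg, g1, add_sub_cancel_right,
      ← Quaternion.coe_mul, mul_assoc, Units.inv_mul, mul_one]
  · rw [pull, imK_coe_mul, rev_neg, rev_rev, mul_neg, Quaternion.imK_neg, k1]
    simp
  · rw [pull, imK_coe_mul, rev_rev, neg_mul, Quaternion.imK_neg, k2]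
    simp

end IsGSV2

/-- `GSV₂(R)`, as a group of invertible matrices over the quaternions. -/
def GSV2 (R : Type*) [CommRing R] : Subgroup (QMat R)ˣ where
  carrier := {M | IsGSV2 (M : QMat R)}
  one_mem' := IsGSV2.one
  mul_mem' hM hN := IsGSV2.mul hM hN
  inv_mem' hM := IsGSV2.inv hM

theorem IsGSV2.map {R S : Type*} [CommRing R] [CommRing S] (f : R →+* S) {M : QMat R}
    (hM : IsGSV2 M) : IsGSV2 (QMat.map f M) := by
  obtain ⟨⟨μ, h1⟩, h2, h3⟩ := hM
  refine ⟨⟨Units.map (f : R →* S) μ, ?_⟩, ?_, ?_⟩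
  · simp only [QMat.map_apply, ← Quat.map_rev, ← map_mul, ← map_sub, h1, Quat.map_coe]
    rfl
  · simp only [QMat.map_apply, ← Quat.map_rev, ← map_mul, Quat.imK_map, h2, map_zero]
  · simp only [QMat.map_apply, ← Quat.map_rev, ← map_mul, Quat.imK_map, h3, map_zero]

/-- The homomorphism `SV₂(R) → SV₂(S)` induced by a ring homomorphism `R → S`. -/
def SV2.map {R S : Type*} [CommRing R] [CommRing S] (f : R →+* S) : SV2 R →* SV2 S :=
  ((Units.map (QMat.map f : QMat R →* QMat S)).comp (SV2 R).subtype).codRestrict (SV2 S) (by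
    intro g
    have h : (g.1 : QMat R) * QMat.J R * QMat.dag (g.1 : QMat R) = QMat.J R := g.2
    change QMat.map f (g.1 : QMat R) * QMat.J S * QMat.dag (QMat.map f (g.1 : QMat R)) = QMat.J S
    rw [← QMat.map_J f, ← QMat.map_dag, ← map_mul, ← map_mul, h])

/-- The homomorphism `GSV₂(R) → GSV₂(S)` induced by a ring homomorphism `R → S`. -/
def GSV2.map {R S : Type*} [CommRing R] [CommRing S] (f : R →+* S) : GSV2 R →* GSV2 S :=
  ((Units.map (QMat.map f : QMat R →* QMat S)).comp (GSV2 R).subtype).codRestrict (GSV2 S)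
    (fun g => IsGSV2.map f g.2)

theorem SV2.isGSV2 {R : Type*} [CommRing R] [IsDomain R] [CharZero R] {M : QMat R}
    (hM : M * QMat.J R * QMat.dag M = QMat.J R) : IsGSV2 M := by
  have aux {x y : ℍ[R]} (h : -(x * Quat.rev y) + y * Quat.rev x = 0) :
      (y * Quat.rev x).imK = 0 := by
    have h' : Quat.rev (y * Quat.rev x) = y * Quat.rev x := by
      rw [Quat.rev_mul, Quat.rev_rev]
      exact neg_add_eq_zero.mp h
    have := congrArg QuaternionAlgebra.imK h'
    rw [Quat.imK_rev] at this
    exact self_eq_neg.mp this.symm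
  have h1 := congrFun (congrFun hM 0) 0
  have h2 := congrFun (congrFun hM 0) 1
  have h3 := congrFun (congrFun hM 1) 1
  simp only [QMat.dag, QMat.J, Matrix.mul_apply, Fin.sum_univ_two, Matrix.of_apply,
    Matrix.cons_val', Matrix.cons_val_zero, Matrix.cons_val_one, Matrix.cons_val_fin_one,
    Matrix.transpose_apply, Matrix.map_apply, mul_zero, mul_one, mul_neg, zero_add, add_zero,
    neg_mul] at h1 h2 h3
  refine ⟨⟨1, ?_⟩, aux h1, aux h3⟩
  rw [sub_eq_neg_add, h2]
  simp

/-- The inclusion of `SV₂(R)` in `GSV₂(R)`, for a domain `R` of characteristic zero. -/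
def SV2.toGSV2 {R : Type*} [CommRing R] [IsDomain R] [CharZero R] : SV2 R →* GSV2 R :=
  Subgroup.inclusion (fun _ hM => SV2.isGSV2 hM)

/-- `PGSV₂(R)`, the quotient of `GSV₂(R)` by its centre. -/
abbrev PGSV2 (R : Type*) [CommRing R] := GSV2 R ⧸ Subgroup.center (GSV2 R)

/-- The projection `GSV₂(R) → PGSV₂(R)`. -/
def GSV2.proj (R : Type*) [CommRing R] : GSV2 R →* PGSV2 R :=
  QuotientGroup.mk' (Subgroup.center (GSV2 R))

/-- The homomorphism `SV₂(R) → PGSV₂(R)`. -/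
def SV2.toPGSV2 {R : Type*} [CommRing R] [IsDomain R] [CharZero R] : SV2 R →* PGSV2 R :=
  (GSV2.proj R).comp SV2.toGSV2

/-- The matrices of `GSV₂(R)` in whose entries the coefficients of `j` and `k` vanish. -/
def GSV2.noJK (R : Type*) [CommRing R] : Subgroup (GSV2 R) where
  carrier := {M | ∀ i j, ((M.1 : QMat R) i j).imJ = 0 ∧ ((M.1 : QMat R) i j).imK = 0}
  one_mem' i j := by
    fin_cases i <;> fin_cases j <;> simp
  mul_mem' {M N} hM hN i j := by
    simp only [Set.mem_ofPred_eq] at hM hN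
    simp [Matrix.mul_apply, Fin.sum_univ_two, hM, hN]
  inv_mem' {M} hM i j := by
    simp only [Set.mem_ofPred_eq] at hM
    obtain ⟨μ, h1⟩ := M.2.1
    have h := (IsGSV2.inv_apply M.2 h1).2 i j
    change ((((M.1)⁻¹ : (QMat R)ˣ) : QMat R) i j).imJ = 0 ∧
      ((((M.1)⁻¹ : (QMat R)ˣ) : QMat R) i j).imK = 0
    rw [h]
    fin_cases i <;> fin_cases j <;> simp [IsGSV2.adj, hM]

/-- The points over `R` of the subgroup `𝐇` of `PGSV₂` obtained by requiring the
coefficients of `j` and `k` in each matrix entry to vanish. -/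
def HPoints (R : Type*) [CommRing R] : Subgroup (PGSV2 R) :=
  (GSV2.noJK R).map (GSV2.proj R)

/-- For `g ∈ SV₂(F)`, the points of the conjugate `g𝐇g⁻¹` over a domain `R` of characteristic
zero that is an extension of `F` by means of `φ : F → R`. -/
def conjHPoints {F R : Type*} [CommRing F] [CommRing R] [IsDomain R] [CharZero R]
    (g : SV2 F) (φ : F →+* R) : Subgroup (PGSV2 R) :=
  (HPoints R).map (MulAut.conj (SV2.toPGSV2 (SV2.map φ g))).toMonoidHom

/-- The field `ℚ̄ ∩ ℝ`. -/
noncomputable abbrev RealAlg : IntermediateField ℚ ℝ := algebraicClosure ℚ ℝ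

/-- The set of all coefficients of the four quaternionic entries of `g`. -/
def coeffs {R : Type*} [CommRing R] (g : SV2 R) : Set R :=
  {x | ∃ i j, x = ((g.1 : QMat R) i j).re ∨ x = ((g.1 : QMat R) i j).imI ∨
    x = ((g.1 : QMat R) i j).imJ ∨ x = ((g.1 : QMat R) i j).imK}

/-- The smallest subfield `F` of `ℚ̄ ∩ ℝ` with `g ∈ SV₂(F)`: the field generated by the
coefficients of `g`. -/
noncomputable def coeffField (g : SV2 RealAlg) : IntermediateField ℚ RealAlg :=
  IntermediateField.adjoin ℚ (coeffs g)

/-- A quaternion whose coefficients lie in a subfield, as a quaternion over this subfield. -/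
noncomputable def Quat.lift (F : IntermediateField ℚ RealAlg) (z : ℍ[RealAlg])
    (h : z.re ∈ F ∧ z.imI ∈ F ∧ z.imJ ∈ F ∧ z.imK ∈ F) : ℍ[F] :=
  ⟨⟨z.re, h.1⟩, ⟨z.imI, h.2.1⟩, ⟨z.imJ, h.2.2.1⟩, ⟨z.imK, h.2.2.2⟩⟩

theorem Quat.map_lift (F : IntermediateField ℚ RealAlg) (z : ℍ[RealAlg])
    (h : z.re ∈ F ∧ z.imI ∈ F ∧ z.imJ ∈ F ∧ z.imK ∈ F) :
    Quat.map F.val.toRingHom (Quat.lift F z h) = z := rfl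

theorem coeffField_mem (g : SV2 RealAlg) (i j : Fin 2) :
    ((g.1 : QMat RealAlg) i j).re ∈ coeffField g ∧
    ((g.1 : QMat RealAlg) i j).imI ∈ coeffField g ∧
    ((g.1 : QMat RealAlg) i j).imJ ∈ coeffField g ∧
    ((g.1 : QMat RealAlg) i j).imK ∈ coeffField g := by
  refine ⟨?_, ?_, ?_, ?_⟩ <;>
    refine IntermediateField.subset_adjoin ℚ _ ⟨i, j, ?_⟩ <;> simp

theorem exists_descend (g : SV2 RealAlg) :
    ∃ g₀ : SV2 (coeffField g), SV2.map (coeffField g).val.toRingHom g₀ = g := by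
  set f : coeffField g →+* RealAlg := (coeffField g).val.toRingHom with hf
  have hinj : Function.Injective (QMat.map f) := QMat.map_injective f.injective
  let M : QMat (coeffField g) := fun i j =>
    Quat.lift (coeffField g) ((g.1 : QMat RealAlg) i j) (coeffField_mem g i j)
  have hM : QMat.map f M = (g.1 : QMat RealAlg) := rfl
  have hg : (g.1 : QMat RealAlg) * QMat.J RealAlg * QMat.dag (g.1 : QMat RealAlg) =
    QMat.J RealAlg := g.2
  have hJ {R : Type} [CommRing R] : QMat.J R * -QMat.J R = 1 := by
    ext1 i j
    fin_cases i <;> fin_cases j <;> simp [QMat.J, Matrix.mul_apply, Fin.sum_univ_two]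
  have h1 : M * (QMat.J _ * QMat.dag M * -QMat.J _) = 1 := by
    apply hinj
    rw [map_mul, map_mul, map_mul, map_neg, QMat.map_J, QMat.map_dag, hM, map_one,
      ← mul_assoc, ← mul_assoc, hg, hJ]
  have h2 : (QMat.J _ * QMat.dag M * -QMat.J _) * M = 1 := by
    apply hinj
    have h1' := congrArg (QMat.map f) h1
    rw [map_mul, map_one, hM] at h1'
    rw [map_mul, map_one, hM, ← Units.inv_eq_of_mul_eq_one_right h1', Units.inv_mul]
  refine ⟨⟨⟨M, _, h1, h2⟩, ?_⟩, ?_⟩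
  · change M * QMat.J _ * QMat.dag M = QMat.J _
    apply hinj
    rw [map_mul, map_mul, QMat.map_J, QMat.map_dag, hM, hg]
  · apply Subtype.ext
    apply Units.ext
    exact hM

/-- The element `g`, viewed in `SV₂(F)` for the field `F` generated by its coefficients. -/
noncomputable def descend (g : SV2 RealAlg) : SV2 (coeffField g) :=
  (exists_descend g).choose

theorem map_descend (g : SV2 RealAlg) :
    SV2.map (coeffField g).val.toRingHom (descend g) = g :=
  (exists_descend g).choose_spec

section padic
variable (p : ℕ) [Fact p.Prime]

/-- The embedding `φ` of the coefficient field of `g` in `ℚ_p` maps `g` into `SV₂(ℤ_p)`. -/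
def MapsToIntegral (g : SV2 RealAlg) (φ : coeffField g →+* ℚ_[p]) : Prop :=
  SV2.map φ (descend g) ∈ (SV2.map (PadicInt.Coe.ringHom (p := p))).range

/-- The prime `p` is good for `g`: it is `3` modulo `4`, and the coefficient field of `g` has
an embedding in `ℚ_p` that maps `g` into `SV₂(ℤ_p)`. -/
def IsGood (g : SV2 RealAlg) : Prop :=
  p % 4 = 3 ∧ ∃ φ : coeffField g →+* ℚ_[p], MapsToIntegral p g φ

/-- `K_p`, the image of `PGSV₂(ℤ_p)`, that is, of `GSV₂(ℤ_p)`, in `PGSV₂(ℚ_p)`. -/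
noncomputable def Kp : Subgroup (PGSV2 ℚ_[p]) :=
  (GSV2.map (PadicInt.Coe.ringHom (p := p))).range.map (GSV2.proj ℚ_[p])

/-- For a subgroup `V` and an element `x` of `PGSV₂(ℚ_p)`, the number
`|(V K_p ∩ K_p x K_p) / K_p|` of cosets `y K_p`, possibly infinite. -/
noncomputable def cosetCount (V : Subgroup (PGSV2 ℚ_[p])) (x : PGSV2 ℚ_[p]) : ℕ∞ :=
  ((fun y : PGSV2 ℚ_[p] => (y : PGSV2 ℚ_[p] ⧸ Kp p)) ''
    (((V : Set (PGSV2 ℚ_[p])) * (Kp p : Set (PGSV2 ℚ_[p]))) ∩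
      ((Kp p : Set (PGSV2 ℚ_[p])) * {x} * (Kp p : Set (PGSV2 ℚ_[p]))))).encard

end padic

/-- The diagonal matrix `diag(1, u)` in `GSV₂(R)`, for a unit `u` of `R`. -/
def GSV2.diagOne {R : Type*} [CommRing R] (u : Rˣ) : GSV2 R :=
  ⟨⟨!![1, 0; 0, ((u : R) : ℍ[R])], !![1, 0; 0, (((u⁻¹ : Rˣ) : R) : ℍ[R])],
    by
      ext1 i j
      fin_cases i <;> fin_cases j <;>
        simp [Matrix.mul_apply, Fin.sum_univ_two, ← Quaternion.coe_mul],
    by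
      ext1 i j
      fin_cases i <;> fin_cases j <;>
        simp [Matrix.mul_apply, Fin.sum_univ_two, ← Quaternion.coe_mul]⟩,
    by
      refine ⟨⟨u, ?_⟩, ?_, ?_⟩
      · simp [Quat.rev_coe, Quat.rev_zero]
      · simp [Quat.rev_zero]
      · simp⟩

/-- The class of `diag(1, p^l)` in `PGSV₂(ℚ_p)`. -/
noncomputable def diagPow (p : ℕ) [hp : Fact p.Prime] (l : ℕ) : PGSV2 ℚ_[p] :=
  GSV2.proj ℚ_[p] (GSV2.diagOne
    ((Units.mk0 (p : ℚ_[p]) (Nat.cast_ne_zero.mpr hp.out.ne_zero)) ^ l))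

/-! The conjugating element costs nothing: since `φ(g)` is integral, its class `γ` lies in `K_p`. If
`γ h γ⁻¹ κ` lies in `K_p diag(1, p^l) K_p`, so does `h`, and the coset of `γ h γ⁻¹ κ` is `γ` times
that of `h`. It therefore suffices to count the cosets `h K_p` with `h` in `𝐇(ℚ_p)` inside this
double coset, and the bound does not depend on `g`.

Such an `h` is the class of a product `k₁ diag(1, p^l) k₂` with `k₁`, `k₂` in `GSV₂(ℤ_p)`. The
centre of `GSV₂(ℚ_p)` consists of matrices over `ℚ_p[i]` (`GSV2.center_le_noJK`), so this product,
and not merely a central multiple of it, is a matrix over `ℤ_p[i]`. Its determinant is its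
similitude factor, a unit of `ℤ_p` times `p^l`.

For `p ≡ 3 mod 4` the prime `p` is inert, so every nonzero element of `ℤ_p[i]` is a power of `p`
times a unit. Column operations with determinant in `ℤ_pˣ` belong to `GSV₂(ℤ_p)` and reduce the
matrix to upper triangular form with diagonal `p^i, p^(l-i)` and upper right entry a residue modulo
`p^i` (`exists_hermite`). There are `p^(2i)` residues for each `i ≤ l`, and the geometric sum is at
most `2 p^(2l)`. -/

/-- The commutative ring `R[i]` with `i² = -1`. -/
abbrev GaussRing (R : Type*) [CommRing R] := QuadraticAlgebra R (-1) 0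

/-! ### Arithmetic of `ℤ_p[i]` for `p` inert. -/

namespace PadicInt

variable {p : ℕ} [hp : Fact p.Prime]

/-- Otherwise reduction modulo `p` would make `-1` a square in `ZMod p`. -/
theorem isUnit_one_add_sq (h3 : p % 4 = 3) (t : ℤ_[p]) : IsUnit (1 + t * t) := by
  by_contra h
  have h1 : 1 + t * t ∈ IsLocalRing.maximalIdeal ℤ_[p] := h
  rw [← ker_toZMod, RingHom.mem_ker, map_add, map_one, map_mul] at h1
  have h2 : toZMod t ^ 2 = -1 := by linear_combination h1
  exact ZMod.mod_four_ne_three_of_sq_eq_neg_one h2 h3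

end PadicInt

namespace GaussRing

variable {p : ℕ} [hp : Fact p.Prime]

theorem re_natCast_pow_mul (m n : ℕ) (x : GaussRing ℤ_[p]) :
    ((m : GaussRing ℤ_[p]) ^ n * x).re = (m : ℤ_[p]) ^ n * x.re := by
  rw [← QuadraticAlgebra.C_natCast, ← QuadraticAlgebra.C_pow, QuadraticAlgebra.C_mul_eq_smul,
    QuadraticAlgebra.re_smul, smul_eq_mul]

theorem im_natCast_pow_mul (m n : ℕ) (x : GaussRing ℤ_[p]) :
    ((m : GaussRing ℤ_[p]) ^ n * x).im = (m : ℤ_[p]) ^ n * x.im := by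
  rw [← QuadraticAlgebra.C_natCast, ← QuadraticAlgebra.C_pow, QuadraticAlgebra.C_mul_eq_smul,
    QuadraticAlgebra.im_smul, smul_eq_mul]

/-- This says that `p` is a uniformizer of `ℤ_p[i]`. Taking out the coefficient of smaller valuation
leaves `1 + t i` or `t + i`, whose norm `1 + t²` is a unit. -/
theorem exists_eq_pow_mul_unit (h3 : p % 4 = 3) {x : GaussRing ℤ_[p]} (hx : x ≠ 0) :
    ∃ (n : ℕ) (v : (GaussRing ℤ_[p])ˣ), x = (p : GaussRing ℤ_[p]) ^ n * v := by
  have aux (r : ℤ_[p]) (hr : r ≠ 0) (w : GaussRing ℤ_[p]) (hw : IsUnit w.norm)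
      (hxw : x = QuadraticAlgebra.C r * w) :
      ∃ (n : ℕ) (v : (GaussRing ℤ_[p])ˣ), x = (p : GaussRing ℤ_[p]) ^ n * v := by
    obtain ⟨v, rfl⟩ := QuadraticAlgebra.isUnit_iff_norm_isUnit.mpr hw
    refine ⟨r.valuation, Units.map (algebraMap ℤ_[p] (GaussRing ℤ_[p]) : _ →* _)
      (PadicInt.unitCoeff hr) * v, ?_⟩
    rw [hxw]
    conv_lhs => rw [PadicInt.unitCoeff_spec hr]
    rw [QuadraticAlgebra.C_mul, QuadraticAlgebra.C_pow, QuadraticAlgebra.C_natCast]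
    simp only [Units.val_mul, Units.coe_map, MonoidHom.coe_coe, QuadraticAlgebra.C_eq_algebraMap]
    ring
  rcases ValuationRing.dvd_total x.re x.im with ⟨t, ht⟩ | ⟨t, ht⟩
  · refine aux x.re (fun h => hx ?_) ⟨1, t⟩ ?_ ?_
    · ext <;> simp [h, ht]
    · simpa [QuadraticAlgebra.norm_def] using PadicInt.isUnit_one_add_sq h3 t
    · ext <;> simp [ht]
  · refine aux x.im (fun h => hx ?_) ⟨t, 1⟩ ?_ ?_
    · ext <;> simp [h, ht]
    · simpa [QuadraticAlgebra.norm_def, add_comm] using PadicInt.isUnit_one_add_sq h3 t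
    · ext <;> simp [ht]

theorem dvd_total (h3 : p % 4 = 3) (x y : GaussRing ℤ_[p]) : x ∣ y ∨ y ∣ x := by
  by_cases hx : x = 0
  · exact Or.inr (hx ▸ dvd_zero y)
  by_cases hy : y = 0
  · exact Or.inl (hy ▸ dvd_zero x)
  obtain ⟨m, v, rfl⟩ := exists_eq_pow_mul_unit h3 hx
  obtain ⟨n, w, rfl⟩ := exists_eq_pow_mul_unit h3 hy
  rw [Units.mul_right_dvd, Units.dvd_mul_right, Units.mul_right_dvd, Units.dvd_mul_right]
  exact (le_total m n).imp (pow_dvd_pow _) (pow_dvd_pow _)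

/-! ### Hermite normal form over `ℤ_p[i]`. -/

/-- A row vector over `ℤ_p[i]` can be brought to the form `(0, p ^ j)` or `(0, 0)` by a
column operation of determinant one. -/
theorem exists_row_reduction (h3 : p % 4 = 3) (c d : GaussRing ℤ_[p]) :
    ∃ B : Matrix (Fin 2) (Fin 2) (GaussRing ℤ_[p]), B.det = 1 ∧ c * B 0 0 + d * B 1 0 = 0 ∧
      (c * B 0 1 + d * B 1 1 = 0 ∨ ∃ j : ℕ, c * B 0 1 + d * B 1 1 = (p : GaussRing ℤ_[p]) ^ j) := by
  have scale (d : GaussRing ℤ_[p]) : ∃ v : (GaussRing ℤ_[p])ˣ,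
      d * v = 0 ∨ ∃ j : ℕ, d * v = (p : GaussRing ℤ_[p]) ^ j := by
    by_cases hd : d = 0
    · exact ⟨1, Or.inl (by simp [hd])⟩
    · obtain ⟨j, v, rfl⟩ := exists_eq_pow_mul_unit h3 hd
      exact ⟨v⁻¹, Or.inr ⟨j, by simp⟩⟩
  -- The entry of smaller valuation clears the other. Making it a power of `p` takes a unit `v` of
  -- `ℤ_p[i]`, possibly outside `ℤ_p`; `v⁻¹` on the other column restores determinant one.
  rcases dvd_total h3 d c with ⟨e, rfl⟩ | ⟨e, rfl⟩
  · obtain ⟨v, hv⟩ := scale d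
    refine ⟨!![((v⁻¹ : (GaussRing ℤ_[p])ˣ) : GaussRing ℤ_[p]), 0;
      -e * ((v⁻¹ : (GaussRing ℤ_[p])ˣ) : GaussRing ℤ_[p]), v], ?_, ?_, ?_⟩
    · simp [Matrix.det_fin_two]
    · simp; ring
    · simpa using hv
  · obtain ⟨v, hv⟩ := scale c
    refine ⟨!![e * ((v⁻¹ : (GaussRing ℤ_[p])ˣ) : GaussRing ℤ_[p]), v;
      -((v⁻¹ : (GaussRing ℤ_[p])ˣ) : GaussRing ℤ_[p]), 0], ?_, ?_, ?_⟩
    · simp [Matrix.det_fin_two]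
    · simp; ring
    · simpa using hv

/-- Every element of `ℤ_p[i]` is congruent modulo `p ^ i` to one with coefficients in
`{0, …, p ^ i - 1}`. -/
theorem exists_residue (x : GaussRing ℤ_[p]) (i : ℕ) :
    ∃ (m n : Fin (p ^ i)) (t : GaussRing ℤ_[p]),
      x = ⟨(m : ℕ), (n : ℕ)⟩ + (p : GaussRing ℤ_[p]) ^ i * t := by
  obtain ⟨r, hr⟩ := Ideal.mem_span_singleton.mp (PadicInt.appr_spec i x.re)
  obtain ⟨s, hs⟩ := Ideal.mem_span_singleton.mp (PadicInt.appr_spec i x.im)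
  refine ⟨⟨_, PadicInt.appr_lt x.re i⟩, ⟨_, PadicInt.appr_lt x.im i⟩, ⟨r, s⟩, ?_⟩
  ext
  · rw [QuadraticAlgebra.re_add, re_natCast_pow_mul, ← hr, add_sub_cancel]
  · rw [QuadraticAlgebra.im_add, im_natCast_pow_mul, ← hs, add_sub_cancel]

/-- The Hermite normal form for the action on the right of the matrices over `ℤ_p[i]` with
determinant in `ℤ_pˣ`. -/
theorem exists_hermite (h3 : p % 4 = 3) {A : Matrix (Fin 2) (Fin 2) (GaussRing ℤ_[p])}
    {u : ℤ_[p]ˣ} {l : ℕ} (hA : A.det = algebraMap ℤ_[p] _ (u * (p : ℤ_[p]) ^ l)) :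
    ∃ (B : Matrix (Fin 2) (Fin 2) (GaussRing ℤ_[p])) (v : ℤ_[p]ˣ) (i : ℕ) (m n : Fin (p ^ i)),
      B.det = algebraMap ℤ_[p] _ (v : ℤ_[p]) ∧ i ≤ l ∧
      A * B = !![(p : GaussRing ℤ_[p]) ^ i, ⟨(m : ℕ), (n : ℕ)⟩;
        0, (p : GaussRing ℤ_[p]) ^ (l - i)] := by
  have hp0 : (p : ℤ_[p]) ≠ 0 := Nat.cast_ne_zero.mpr hp.out.ne_zero
  obtain ⟨B, hB, h0, hd⟩ := exists_row_reduction h3 (A 1 0) (A 1 1)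
  have hdet := congrArg₂ (· * ·) hA hB
  simp only [← Matrix.det_mul, mul_one] at hdet
  have e10 : (A * B) 1 0 = 0 := by rw [Matrix.mul_apply, Fin.sum_univ_two, h0]
  rw [Matrix.det_fin_two, e10, mul_zero, sub_zero] at hdet
  have e11 : (A * B) 1 1 = A 1 0 * B 0 1 + A 1 1 * B 1 1 := by
    rw [Matrix.mul_apply, Fin.sum_univ_two]
  rw [← e11] at hd
  -- A zero bottom row would contradict the nonvanishing of the determinant.
  obtain hd | ⟨j, hd⟩ := hd
  · rw [hd, mul_zero] at hdet
    have := congrArg QuadraticAlgebra.re hdet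
    rw [QuadraticAlgebra.algebraMap_re, QuadraticAlgebra.re_zero] at this
    exact absurd this.symm (mul_ne_zero u.ne_zero (pow_ne_zero l hp0))
  rw [hd] at hdet
  have hre : ((A * B) 0 0).re * (p : ℤ_[p]) ^ j = u * (p : ℤ_[p]) ^ l := by
    have := congrArg QuadraticAlgebra.re hdet
    rwa [mul_comm, re_natCast_pow_mul, mul_comm, QuadraticAlgebra.algebraMap_re] at this
  have him : ((A * B) 0 0).im * (p : ℤ_[p]) ^ j = 0 := by
    have := congrArg QuadraticAlgebra.im hdet
    rwa [mul_comm, im_natCast_pow_mul, mul_comm, QuadraticAlgebra.algebraMap_im] at this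
  have hjl : j ≤ l := by
    have h1 : (p : ℤ_[p]) ^ j ∣ (p : ℤ_[p]) ^ l :=
      (Units.dvd_mul_left (u := u)).mp (hre ▸ Dvd.intro_left _ rfl)
    exact (pow_dvd_pow_iff hp0 PadicInt.prime_p.not_isUnit).mp h1
  -- The determinant and `p^j` both lie in `ℤ_p`, hence so does the remaining corner; normalising it
  -- needs only the unit `u` of `ℤ_p`.
  have e00 : (A * B) 0 0 = algebraMap ℤ_[p] _ (u : ℤ_[p]) * (p : GaussRing ℤ_[p]) ^ (l - j) := by
    rw [← QuadraticAlgebra.C_natCast, ← QuadraticAlgebra.C_pow, ← QuadraticAlgebra.C_eq_algebraMap,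
      ← QuadraticAlgebra.C_mul]
    ext
    · apply mul_right_cancel₀ (pow_ne_zero j hp0)
      rw [hre, QuadraticAlgebra.re_C, mul_assoc, ← pow_add, Nat.sub_add_cancel hjl]
    · rw [QuadraticAlgebra.im_C]
      exact (mul_eq_zero.mp him).resolve_right (pow_ne_zero j hp0)
  obtain ⟨m, n, t, ht⟩ := exists_residue ((A * B) 0 1) (l - j)
  have hu : algebraMap ℤ_[p] (GaussRing ℤ_[p]) (u : ℤ_[p]) *
      algebraMap ℤ_[p] (GaussRing ℤ_[p]) ((u⁻¹ : ℤ_[p]ˣ) : ℤ_[p]) = 1 := by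
    rw [← map_mul, Units.mul_inv, map_one]
  -- The first column is divided by `u`, and `t` times the result is subtracted from the second,
  -- leaving the chosen residue in the upper right corner.
  refine ⟨B * !![algebraMap ℤ_[p] _ ((u⁻¹ : ℤ_[p]ˣ) : ℤ_[p]),
    -algebraMap ℤ_[p] _ ((u⁻¹ : ℤ_[p]ˣ) : ℤ_[p]) * t; 0, 1], u⁻¹, l - j, m, n, ?_,
    Nat.sub_le _ _, ?_⟩
  · rw [Matrix.det_mul, hB, Matrix.det_fin_two]
    simp
  · rw [← Matrix.mul_assoc, Matrix.eta_fin_two (A * B), e10, hd, e00, ht, Matrix.mul_fin_two,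
      Nat.sub_sub_self hjl]
    ext1 a b
    fin_cases a <;> fin_cases b
    · simp [mul_right_comm _ _ (algebraMap ℤ_[p] (GaussRing ℤ_[p]) _), hu]
    · simp only [Fin.zero_eta, Fin.mk_one, Matrix.of_apply, Matrix.cons_val', Matrix.cons_val_zero,
        Matrix.cons_val_one, Matrix.cons_val_fin_one]
      linear_combination (-(p : GaussRing ℤ_[p]) ^ (l - j) * t) * hu
    · simp
    · simp

end GaussRing

/-! ### Matrices over `R[i]` inside the quaternionic matrices. -/

namespace GaussRing

variable {R S : Type*} [CommRing R] [CommRing S]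

/-- The function underlying the embedding of `R[i]` in the Hamilton quaternions over `R`. -/
def toQuatFun (x : GaussRing R) : ℍ[R] := ⟨x.re, x.im, 0, 0⟩

@[simp] theorem re_toQuatFun (x : GaussRing R) : (toQuatFun x).re = x.re := rfl
@[simp] theorem imI_toQuatFun (x : GaussRing R) : (toQuatFun x).imI = x.im := rfl
@[simp] theorem imJ_toQuatFun (x : GaussRing R) : (toQuatFun x).imJ = 0 := rfl
@[simp] theorem imK_toQuatFun (x : GaussRing R) : (toQuatFun x).imK = 0 := rfl

/-- The embedding of `R[i]` in the Hamilton quaternions over `R`. -/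
def toQuat (R : Type*) [CommRing R] : GaussRing R →+* ℍ[R] where
  toFun := toQuatFun
  map_one' := by ext <;> simp [QuadraticAlgebra.re_one, QuadraticAlgebra.im_one]
  map_mul' x y := by ext <;> simp; ring
  map_zero' := by ext <;> simp
  map_add' x y := by ext <;> simp

@[simp] theorem re_toQuat (x : GaussRing R) : (toQuat R x).re = x.re := rfl
@[simp] theorem imI_toQuat (x : GaussRing R) : (toQuat R x).imI = x.im := rfl
@[simp] theorem imJ_toQuat (x : GaussRing R) : (toQuat R x).imJ = 0 := rfl
@[simp] theorem imK_toQuat (x : GaussRing R) : (toQuat R x).imK = 0 := rfl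

theorem toQuat_injective : Function.Injective (toQuat R) := fun _ _ h =>
  QuadraticAlgebra.ext (congrArg QuaternionAlgebra.re h) (congrArg QuaternionAlgebra.imI h)

theorem rev_toQuat (x : GaussRing R) : Quat.rev (toQuat R x) = toQuat R x :=
  Quat.rev_eq_of_imK rfl

theorem toQuat_algebraMap (r : R) : toQuat R (algebraMap R (GaussRing R) r) = (r : ℍ[R]) := by
  ext <;> simp

/-- The embedding of `M₂(R[i])` in `M₂(ℍ(R))`. -/
def toQMat (R : Type*) [CommRing R] : Matrix (Fin 2) (Fin 2) (GaussRing R) →+* QMat R :=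
  (toQuat R).mapMatrix

theorem toQMat_apply (A : Matrix (Fin 2) (Fin 2) (GaussRing R)) (i j : Fin 2) :
    toQMat R A i j = toQuat R (A i j) := rfl

/-- The ring `R[i]` is commutative and fixed by `rev`, so on these matrices the similitude factor is
the ordinary determinant. -/
theorem toQMat_similitude (A : Matrix (Fin 2) (Fin 2) (GaussRing R)) :
    toQMat R A 0 0 * Quat.rev (toQMat R A 1 1) - toQMat R A 0 1 * Quat.rev (toQMat R A 1 0) =
      toQuat R A.det := by
  simp only [toQMat_apply, rev_toQuat, Matrix.det_fin_two, map_sub, map_mul]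

theorem isGSV2_toQMat {A : Matrix (Fin 2) (Fin 2) (GaussRing R)} {v : Rˣ}
    (hA : A.det = algebraMap R _ (v : R)) : IsGSV2 (toQMat R A) := by
  refine ⟨⟨v, ?_⟩, ?_, ?_⟩
  · rw [toQMat_similitude, hA, toQuat_algebraMap]
  · rw [toQMat_apply, toQMat_apply, rev_toQuat, ← map_mul, imK_toQuat]
  · rw [toQMat_apply, toQMat_apply, rev_toQuat, ← map_mul, imK_toQuat]

/-- The element of `GSV₂(R)` given by a matrix over `R[i]` whose determinant is in `Rˣ`. -/
def toGSV2 (A : Matrix (Fin 2) (Fin 2) (GaussRing R)) (v : Rˣ)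
    (hA : A.det = algebraMap R _ (v : R)) : GSV2 R :=
  ⟨⟨toQMat R A, toQMat R (algebraMap R (GaussRing R) ((v⁻¹ : Rˣ) : R) • A.adjugate),
    by rw [← map_mul, Matrix.mul_smul, Matrix.mul_adjugate, hA, smul_smul, ← map_mul,
      Units.inv_mul, map_one, one_smul, map_one],
    by rw [← map_mul, Matrix.smul_mul, Matrix.adjugate_mul, hA, smul_smul, ← map_mul,
      Units.inv_mul, map_one, one_smul, map_one]⟩, isGSV2_toQMat hA⟩

theorem coe_toGSV2 (A : Matrix (Fin 2) (Fin 2) (GaussRing R)) (v : Rˣ)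
    (hA : A.det = algebraMap R _ (v : R)) : ((toGSV2 A v hA).1 : QMat R) = toQMat R A := rfl

theorem exists_toQMat_eq {M : QMat R} (hM : ∀ i j, (M i j).imJ = 0 ∧ (M i j).imK = 0) :
    ∃ A, toQMat R A = M := by
  refine ⟨fun i j => ⟨(M i j).re, (M i j).imI⟩, ?_⟩
  ext1 i j
  ext
  · rfl
  · rfl
  · exact (hM i j).1.symm
  · exact (hM i j).2.symm

/-- The matrix with rows `(q ^ i, m + n i)`, `(0, q ^ (l - i))`. -/
def hermiteMatrix (R : Type*) [CommRing R] (q l i m n : ℕ) :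
    Matrix (Fin 2) (Fin 2) (GaussRing R) :=
  !![(q : GaussRing R) ^ i, ⟨m, n⟩; 0, (q : GaussRing R) ^ (l - i)]

theorem det_hermiteMatrix {q l i : ℕ} (hi : i ≤ l) (m n : ℕ) :
    (hermiteMatrix R q l i m n).det = algebraMap R _ ((q : R) ^ l) := by
  rw [hermiteMatrix, Matrix.det_fin_two_of, mul_zero, sub_zero, ← pow_add,
    Nat.add_sub_of_le hi, map_pow, map_natCast]

theorem map_toQMat_hermiteMatrix (f : R →+* S) (q l i m n : ℕ) :
    QMat.map f (toQMat R (hermiteMatrix R q l i m n)) =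
      toQMat S (hermiteMatrix S q l i m n) := by
  ext1 a b
  rw [QMat.map_apply, toQMat_apply, toQMat_apply]
  fin_cases a <;> fin_cases b
  · simp [hermiteMatrix]
  · ext <;> simp [hermiteMatrix]
  · simp [hermiteMatrix]
  · simp [hermiteMatrix]

end GaussRing

/-! ### Similitude factors and the centre. -/

/-- Multiplication on the right by an element of `GSV₂(R)` scales the similitude factor. -/
theorem IsGSV2.similitude_mul {R : Type*} [CommRing R] (M : QMat R) {N : QMat R}
    (hN : IsGSV2 N) :
    ∃ ν : Rˣ, (M * N) 0 0 * Quat.rev ((M * N) 1 1) - (M * N) 0 1 * Quat.rev ((M * N) 1 0) =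
      ((ν : R) : ℍ[R]) * (M 0 0 * Quat.rev (M 1 1) - M 0 1 * Quat.rev (M 1 0)) := by
  obtain ⟨⟨ν, hN1⟩, hN2, hN3⟩ := hN
  refine ⟨ν, ?_⟩
  simp only [Matrix.mul_apply, Fin.sum_univ_two]
  generalize M 0 0 = a, M 0 1 = b, M 1 0 = c, M 1 1 = d at *
  generalize N 0 0 = e, N 0 1 = f, N 1 0 = g, N 1 1 = h at *
  have e1 : f * Quat.rev e = e * Quat.rev f := by
    rw [← Quat.rev_eq_of_imK hN2, Quat.rev_mul, Quat.rev_rev]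
  have e2 : h * Quat.rev g = g * Quat.rev h := by
    rw [← Quat.rev_eq_of_imK hN3, Quat.rev_mul, Quat.rev_rev]
  have e3 : h * Quat.rev e - g * Quat.rev f = ((ν : R) : ℍ[R]) := by
    rw [← Quat.rev_coe, ← hN1, Quat.rev_sub, Quat.rev_mul, Quat.rev_mul, Quat.rev_rev,
      Quat.rev_rev]
  have hcomm (x y : ℍ[R]) : x * (((ν : R) : ℍ[R]) * y) = ((ν : R) : ℍ[R]) * (x * y) := by
    rw [← mul_assoc, ← mul_assoc, Quaternion.coe_commutes (ν : R) x]
  calc _ = a * ((e * Quat.rev f - f * Quat.rev e) * Quat.rev c)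
        + a * ((e * Quat.rev h - f * Quat.rev g) * Quat.rev d)
        - b * ((h * Quat.rev e - g * Quat.rev f) * Quat.rev c)
        + b * ((g * Quat.rev h - h * Quat.rev g) * Quat.rev d) := by
        simp only [Quat.rev_add, Quat.rev_mul]; noncomm_ring
    _ = _ := by
        rw [e1, e2, e3, hN1, hcomm, hcomm]; noncomm_ring

/-- The centre of `GSV₂(R)` is contained in the subgroup of the matrices over `R[i]`. -/
theorem GSV2.center_le_noJK {R : Type*} [CommRing R] [IsDomain R] [CharZero R] :
    Subgroup.center (GSV2 R) ≤ GSV2.noJK R := by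
  intro z hz
  rw [Subgroup.mem_center_iff] at hz
  have comm (A : Matrix (Fin 2) (Fin 2) (GaussRing R)) (hA : A.det = 1) (i j : Fin 2) :
      (GaussRing.toQMat R A * (z.1 : QMat R)) i j =
        ((z.1 : QMat R) * GaussRing.toQMat R A) i j := by
    have h := hz (GaussRing.toGSV2 A 1 (by simpa using hA))
    exact congrFun (congrFun (congrArg (fun y : GSV2 R => (y.1 : QMat R)) h) i) j
  -- Commuting with the two unipotents makes `z` diagonal. Commuting with `diag(i, -i)`, also of
  -- determinant one, then removes the `j` and `k` coefficients of the diagonal entries, as `2 ≠ 0`.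
  have h10 := comm !![1, 1; 0, 1] (by simp) 0 0
  have h01 := comm !![1, 0; 1, 1] (by simp) 0 0
  have hI : (!![⟨0, 1⟩, 0; 0, ⟨0, -1⟩] : Matrix (Fin 2) (Fin 2) (GaussRing R)).det = 1 := by
    rw [Matrix.det_fin_two_of]
    ext <;> simp [QuadraticAlgebra.re_one, QuadraticAlgebra.im_one]
  have h00 := comm _ hI 0 0
  have h11 := comm _ hI 1 1
  simp only [Matrix.mul_apply, Fin.sum_univ_two, GaussRing.toQMat_apply, Matrix.of_apply,
    Matrix.cons_val', Matrix.cons_val_zero, Matrix.cons_val_one, Matrix.cons_val_fin_one,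
    map_one, map_zero, one_mul, mul_one, mul_zero, zero_mul, add_zero, zero_add,
    add_eq_left, left_eq_add] at h10 h01 h00 h11
  have k1 := congrArg QuaternionAlgebra.imJ h00
  have k2 := congrArg QuaternionAlgebra.imK h00
  have k3 := congrArg QuaternionAlgebra.imJ h11
  have k4 := congrArg QuaternionAlgebra.imK h11
  simp at k1 k2 k3 k4
  intro i j
  fin_cases i <;> fin_cases j
  · exact ⟨self_eq_neg.mp k2, neg_eq_self.mp k1⟩
  · exact ⟨congrArg QuaternionAlgebra.imJ h01, congrArg QuaternionAlgebra.imK h01⟩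
  · exact ⟨congrArg QuaternionAlgebra.imJ h10, congrArg QuaternionAlgebra.imK h10⟩
  · exact ⟨neg_eq_self.mp k4, self_eq_neg.mp k3⟩

/-! ### Hermite representatives of the cosets. -/

section padic

variable {p : ℕ} [hp : Fact p.Prime]

open GaussRing

/-- The class in `PGSV₂(ℚ_p)` of a matrix in Hermite normal form with determinant `p ^ l`. -/
noncomputable def hermiteClass (p : ℕ) [hp : Fact p.Prime] (l : ℕ)
    (x : Σ i : Fin (l + 1), Fin (p ^ (i : ℕ)) × Fin (p ^ (i : ℕ))) : PGSV2 ℚ_[p] :=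
  GSV2.proj ℚ_[p] (toGSV2 (hermiteMatrix ℚ_[p] p l x.1 x.2.1 x.2.2)
    ((Units.mk0 (p : ℚ_[p]) (Nat.cast_ne_zero.mpr hp.out.ne_zero)) ^ l)
    (by rw [det_hermiteMatrix (Nat.lt_succ_iff.mp x.1.2)]; simp))

theorem proj_map_mem_Kp (k : GSV2 ℤ_[p]) :
    GSV2.proj ℚ_[p] (GSV2.map (PadicInt.Coe.ringHom (p := p)) k) ∈ Kp p :=
  ⟨_, ⟨k, rfl⟩, rfl⟩

theorem exists_proj_map_of_mem_Kp {κ : PGSV2 ℚ_[p]} (h : κ ∈ Kp p) :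
    ∃ k : GSV2 ℤ_[p], GSV2.proj ℚ_[p] (GSV2.map (PadicInt.Coe.ringHom (p := p)) k) = κ := by
  obtain ⟨_, ⟨k, rfl⟩, rfl⟩ := h
  exact ⟨k, rfl⟩

/-- This is where the integrality of `φ(g)` enters; it allows conjugation by `g` to be absorbed into
`K_p`. -/
theorem toPGSV2_map_mem_Kp {g : SV2 RealAlg} {φ : coeffField g →+* ℚ_[p]}
    (h : MapsToIntegral p g φ) : SV2.toPGSV2 (SV2.map φ (descend g)) ∈ Kp p := by
  obtain ⟨k, hk⟩ := h
  rw [← hk]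
  exact proj_map_mem_Kp (SV2.toGSV2 k)

/-- An integral matrix `k₁ diag(1, p ^ l) k₂` over `ℤ_p[i]`, with `k₁` and `k₂` in `GSV₂(ℤ_p)`,
can be brought to Hermite normal form by an element of `GSV₂(ℤ_p)`. -/
theorem exists_mul_eq_hermiteMatrix (h3 : p % 4 = 3) (k₁ k₂ : GSV2 ℤ_[p]) (l : ℕ)
    (h : ∀ i j, (((k₁.1 : QMat ℤ_[p]) * toQMat _ !![1, 0; 0, (p : GaussRing ℤ_[p]) ^ l] *
        (k₂.1 : QMat ℤ_[p])) i j).imJ = 0 ∧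
      (((k₁.1 : QMat ℤ_[p]) * toQMat _ !![1, 0; 0, (p : GaussRing ℤ_[p]) ^ l] *
        (k₂.1 : QMat ℤ_[p])) i j).imK = 0) :
    ∃ (k : GSV2 ℤ_[p]) (x : Σ i : Fin (l + 1), Fin (p ^ (i : ℕ)) × Fin (p ^ (i : ℕ))),
      (k₁.1 : QMat ℤ_[p]) * toQMat _ !![1, 0; 0, (p : GaussRing ℤ_[p]) ^ l] *
        (k₂.1 : QMat ℤ_[p]) * (k.1 : QMat ℤ_[p]) =
        toQMat _ (hermiteMatrix ℤ_[p] p l x.1 x.2.1 x.2.2) := by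
  obtain ⟨A, hA⟩ := exists_toQMat_eq h
  -- For `l > 0` the left factor is not in `GSV₂(ℤ_p)`, its similitude factor not being a unit; only
  -- the right factor has to be.
  obtain ⟨ν, hν⟩ := IsGSV2.similitude_mul
    ((k₁.1 : QMat ℤ_[p]) * toQMat _ !![1, 0; 0, (p : GaussRing ℤ_[p]) ^ l]) k₂.2
  obtain ⟨μ, hμ⟩ := k₁.2.1
  have hpl : toQuat ℤ_[p] ((p : GaussRing ℤ_[p]) ^ l) = (((p : ℤ_[p]) ^ l : ℤ_[p]) : ℍ[ℤ_[p]]) := by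
    rw [← toQuat_algebraMap, map_pow (algebraMap _ _), map_natCast]
  have hD : ((k₁.1 : QMat ℤ_[p]) * toQMat _ !![1, 0; 0, (p : GaussRing ℤ_[p]) ^ l]) 0 0 *
      Quat.rev (((k₁.1 : QMat ℤ_[p]) * toQMat _ !![1, 0; 0, (p : GaussRing ℤ_[p]) ^ l]) 1 1) -
      ((k₁.1 : QMat ℤ_[p]) * toQMat _ !![1, 0; 0, (p : GaussRing ℤ_[p]) ^ l]) 0 1 *
      Quat.rev (((k₁.1 : QMat ℤ_[p]) * toQMat _ !![1, 0; 0, (p : GaussRing ℤ_[p]) ^ l]) 1 0) =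
      (((p : ℤ_[p]) ^ l : ℤ_[p]) : ℍ[ℤ_[p]]) * ((μ : ℤ_[p]) : ℍ[ℤ_[p]]) := by
    simp only [Matrix.mul_apply, Fin.sum_univ_two, toQMat_apply, Matrix.of_apply,
      Matrix.cons_val', Matrix.cons_val_zero, Matrix.cons_val_one, Matrix.cons_val_fin_one,
      map_one, map_zero, mul_one, mul_zero, add_zero, zero_add, hpl, Quat.rev_mul, Quat.rev_coe]
    rw [← hμ, mul_sub, ← mul_assoc, ← mul_assoc, ← mul_assoc, Quaternion.coe_commutes,
      Quaternion.coe_commutes]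
  rw [hD, ← hA, toQMat_similitude, ← Quaternion.coe_mul, ← Quaternion.coe_mul,
    ← toQuat_algebraMap] at hν
  have hdet : A.det = algebraMap ℤ_[p] _ ((ν * μ : ℤ_[p]ˣ) * (p : ℤ_[p]) ^ l) := by
    rw [toQuat_injective hν, Units.val_mul]
    congr 1
    ring
  obtain ⟨B, v, i, m, n, hB, hi, hAB⟩ := exists_hermite h3 hdet
  refine ⟨toGSV2 B v hB, ⟨⟨i, Nat.lt_succ_of_le hi⟩, m, n⟩, ?_⟩
  rw [← hA, coe_toGSV2, ← map_mul, hAB]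
  rfl

/-- The product need not be invertible over `ℤ_p`, so it is a plain matrix there and a group element
only over `ℚ_p`. Identifying the two carries the vanishing of `j` and `k` coefficients down to `ℤ_p`
and the Hermite form back up. -/
theorem map_mul_diag_mul (k₁ k₂ : GSV2 ℤ_[p]) (l : ℕ) :
    QMat.map (PadicInt.Coe.ringHom (p := p))
      ((k₁.1 : QMat ℤ_[p]) * toQMat _ !![1, 0; 0, (p : GaussRing ℤ_[p]) ^ l] *
        (k₂.1 : QMat ℤ_[p])) =
      ((GSV2.map (PadicInt.Coe.ringHom (p := p)) k₁ * GSV2.diagOne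
        ((Units.mk0 (p : ℚ_[p]) (Nat.cast_ne_zero.mpr hp.out.ne_zero)) ^ l) *
        GSV2.map (PadicInt.Coe.ringHom (p := p)) k₂).1 : QMat ℚ_[p]) := by
  have hD : QMat.map (PadicInt.Coe.ringHom (p := p))
      (toQMat _ !![1, 0; 0, (p : GaussRing ℤ_[p]) ^ l]) =
      ((GSV2.diagOne ((Units.mk0 (p : ℚ_[p])
        (Nat.cast_ne_zero.mpr hp.out.ne_zero)) ^ l)).1 : QMat ℚ_[p]) := by
    ext1 a b
    rw [QMat.map_apply, toQMat_apply]
    fin_cases a <;> fin_cases b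
    · simp [GSV2.diagOne]
    · simp [GSV2.diagOne]
    · simp [GSV2.diagOne]
    · simp only [GSV2.diagOne, Units.val_pow_eq_pow_val, Units.val_mk0, Quaternion.coe_pow,
        Fin.mk_one, Matrix.of_apply, Matrix.cons_val', Matrix.cons_val_one,
        Matrix.cons_val_fin_one, map_pow, map_natCast]
      rfl
  rw [map_mul, map_mul, hD]
  rfl

/-- An element of `𝐇(ℚ_p)` in the double coset of `diag(1, p ^ l)` is represented, modulo `K_p`,
by a matrix in Hermite normal form. -/
theorem exists_hermiteClass (h3 : p % 4 = 3) {l : ℕ} {h κ₁ κ₂ : PGSV2 ℚ_[p]}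
    (hh : h ∈ HPoints ℚ_[p]) (h₁ : κ₁ ∈ Kp p) (h₂ : κ₂ ∈ Kp p)
    (hκ : h = κ₁ * diagPow p l * κ₂) :
    ∃ κ ∈ Kp p, ∃ x, h * κ = hermiteClass p l x := by
  obtain ⟨h₀, hh₀, rfl⟩ := hh
  obtain ⟨k₁, rfl⟩ := exists_proj_map_of_mem_Kp h₁
  obtain ⟨k₂, rfl⟩ := exists_proj_map_of_mem_Kp h₂
  rw [diagPow, ← map_mul, ← map_mul] at hκ
  have hmap := map_mul_diag_mul k₁ k₂ l
  generalize GSV2.map (PadicInt.Coe.ringHom (p := p)) k₁ * GSV2.diagOne ((Units.mk0 (p : ℚ_[p])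
    (Nat.cast_ne_zero.mpr hp.out.ne_zero)) ^ l) * GSV2.map (PadicInt.Coe.ringHom (p := p)) k₂ = y
    at hκ hmap
  -- The representative `y` differs from `h₀` by a central element, which has no `j` or `k`
  -- coefficients either.
  have hy : y ∈ GSV2.noJK ℚ_[p] := by
    have := mul_mem hh₀ (GSV2.center_le_noJK (QuotientGroup.eq.mp hκ))
    rwa [mul_inv_cancel_left] at this
  have hinj : Function.Injective (PadicInt.Coe.ringHom (p := p)) := Subtype.coe_injective
  obtain ⟨k, x, hk⟩ := exists_mul_eq_hermiteMatrix h3 k₁ k₂ l (fun i j => by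
    have h1 := hy i j
    rw [← hmap, QMat.map_apply, Quat.imJ_map, Quat.imK_map, map_eq_zero_iff _ hinj,
      map_eq_zero_iff _ hinj] at h1
    exact h1)
  refine ⟨_, proj_map_mem_Kp k, x, ?_⟩
  rw [hκ, hermiteClass, ← map_mul]
  congr 1
  apply Subtype.ext
  apply Units.ext
  have hk' := congrArg (QMat.map (PadicInt.Coe.ringHom (p := p))) hk
  rw [map_mul, hmap, map_toQMat_hermiteMatrix] at hk'
  rw [coe_toGSV2, Subgroup.coe_mul, Units.val_mul]
  exact hk'

/-- As `2 ≤ q²`, the bound for the earlier terms is at most the new last term. -/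
theorem sum_range_sq_pow_le {q : ℕ} (hq : 2 ≤ q) (l : ℕ) :
    ∑ i ∈ Finset.range (l + 1), q ^ i * q ^ i ≤ 2 * q ^ (2 * l) := by
  induction l with
  | zero => simp
  | succ l ih =>
    rw [Finset.sum_range_succ]
    have h1 : q ^ (2 * (l + 1)) = q * q * q ^ (2 * l) := by ring
    have h2 : q ^ (l + 1) * q ^ (l + 1) = q * q * q ^ (2 * l) := by ring
    have h3 : 2 * q ^ (2 * l) ≤ q * q * q ^ (2 * l) := Nat.mul_le_mul_right _ (by nlinarith)
    omega

end padic

/-! ### The bound. -/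

theorem mainTheorem5 :
    ∃ C : ℕ, ∀ (g : SV2 RealAlg) (p : ℕ) [Fact p.Prime], IsGood p g →
      ∀ φ : coeffField g →+* ℚ_[p], MapsToIntegral p g φ →
        ∀ l : ℕ, cosetCount p (conjHPoints (descend g) φ) (diagPow p l) ≤
          ((C * p ^ (2 * l) : ℕ) : ℕ∞) := by
  refine ⟨2, fun g p hp hgood φ hφ l => ?_⟩
  set γ := SV2.toPGSV2 (SV2.map φ (descend g)) with hγ
  have hγK : γ ∈ Kp p := toPGSV2_map_mem_Kp hφ
  have hsub : (fun y : PGSV2 ℚ_[p] => (y : PGSV2 ℚ_[p] ⧸ Kp p)) ''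
      (((conjHPoints (descend g) φ : Set (PGSV2 ℚ_[p])) * (Kp p : Set (PGSV2 ℚ_[p]))) ∩
        ((Kp p : Set (PGSV2 ℚ_[p])) * {diagPow p l} * (Kp p : Set (PGSV2 ℚ_[p])))) ⊆
      Set.range (fun x => ((γ * hermiteClass p l x : PGSV2 ℚ_[p]) : PGSV2 ℚ_[p] ⧸ Kp p)) := by
    rintro _ ⟨y, ⟨⟨_, ⟨h, hh, rfl⟩, κ, hκ, hy⟩, ⟨_, ⟨κ₁, h₁, _, rfl, rfl⟩, κ₂, h₂, hy'⟩⟩, rfl⟩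
    change γ * h * γ⁻¹ * κ = y at hy
    change κ₁ * diagPow p l * κ₂ = y at hy'
    -- Solving `γ h γ⁻¹ κ = κ₁ diag(1, p^l) κ₂` for `h` puts `h` itself in the double coset, because
    -- `γ` lies in `K_p`.
    obtain ⟨κ', hκ', x, hx⟩ := exists_hermiteClass (h := h) (l := l) hgood.1 hh
      (mul_mem (inv_mem hγK) h₁) (mul_mem (mul_mem h₂ (inv_mem hκ)) hγK) (by
        calc h = γ⁻¹ * (γ * h * γ⁻¹ * κ) * κ⁻¹ * γ := by group
          _ = γ⁻¹ * (κ₁ * diagPow p l * κ₂) * κ⁻¹ * γ := by rw [hy, hy']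
          _ = _ := by group)
    refine ⟨x, ?_⟩
    change ((γ * hermiteClass p l x : PGSV2 ℚ_[p]) : PGSV2 ℚ_[p] ⧸ Kp p) = y
    rw [QuotientGroup.eq, ← hx, ← hy]
    have : (γ * (h * κ'))⁻¹ * (γ * h * γ⁻¹ * κ) = κ'⁻¹ * γ⁻¹ * κ := by group
    rw [this]
    exact mul_mem (mul_mem (inv_mem hκ') (inv_mem hγK)) hκ
  refine (Set.encard_le_encard hsub).trans ?_
  rw [← Set.image_univ]
  refine (Set.encard_image_le _ _).trans ?_
  -- The index set has `p^i · p^i` elements over each `i ≤ l`, one for each residue of `ℤ_p[i]`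
  -- modulo `p^i`.
  rw [Set.encard_univ, ENat.card_eq_coe_fintype_card, Nat.cast_le, Fintype.card_sigma]
  simp only [Fintype.card_prod, Fintype.card_fin]
  rw [Fin.sum_univ_eq_sum_range (fun i => p ^ i * p ^ i)]
  exact sum_range_sq_pow_le hp.out.two_le l
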